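/- Consider the sixth-order member of the second Painlevé hierarchy, with parameter $\alpha$, $$w^{(6)}-14w^2w^{(4)}-56ww'w'''-42w(w'')^2-70(w')^2w''+70w^4w''+140w^3(w')^2-20w^7-zw-\alpha=0.\qquad(\ast)$$ (i) There is exactly one sequence of monic polynomials $Q_n^{[3]}\in\mathbb C[z]$, $n\ge 0$, with $Q_0^{[3]}=1$ such that for every $n\ge 1$ the rational function $w(z;n)=\frac{d}{dz}\ln\frac{Q_{n-1}^{[3]}(z)}{Q_n^{[3]}(z)}$ solves $(\ast)$ with $\alpha=n$. The degree of $Q_n^{[3]}$ is $n(n+1)/2$. (ii) For every $\alpha\in\mathbb C$ the equation $(\ast)$ has exactly one formal solution at infinity of the form $w(z;\alpha)=\sum_{m\ge 0}c_{\alpha,-(m+1)}z^{-m-1}$. The expansion proceeds in steps of $z^{-7}$: $c_{\alpha,-(m+1)}=0$ unless $7\mid m$. (iii) Let $a_{n,k}$, $1\le k\le n(n+1)/2$, be the complex roots of $Q_n^{[3]}$, counted with multiplicity, and let $s_{n,m}=\sum_{k=1}^{n(n+1)/2}a_{n,k}^m$. Then for all integers $n\ge 2$ and $m\ge 1$ $$s_{n,m}=-\sum_{i=2}^{n}c_{i,-(m+1)},$$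 where $c_{i,-(m+1)}$ are the coefficients of the expansion in (ii) at $\alpha=i$. -/

import Mathlib

open Polynomial

namespace PainleveTwo

/-- The left-hand side of the sixth-order member of the second Painlevé hierarchy
`w⁽⁶⁾ - 14 w² w⁗ - 56 w w' w''' - 42 w w''² - 70 w'² w'' + 70 w⁴ w'' + 140 w³ w'² - 20 w⁷ - z w - α`,
over a commutative ring `A` whose derivative `d/dz` is `δ` and whose independent variable is `z`. -/
def sixthOrder {A : Type*} [CommRing A] (δ : A → A) (z α w : A) : A :=
  δ^[6] w - 14 * w ^ 2 * δ^[4] w - 56 * w * δ w * δ^[3] w - 42 * w * (δ^[2] w) ^ 2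
    - 70 * (δ w) ^ 2 * δ^[2] w + 70 * w ^ 4 * δ^[2] w + 140 * w ^ 3 * (δ w) ^ 2
    - 20 * w ^ 7 - z * w - α

/-- The derivative `d/dz` of a rational function, by the quotient rule. -/
noncomputable def ratDeriv (f : RatFunc ℂ) : RatFunc ℂ :=
  algebraMap ℂ[X] (RatFunc ℂ) (derivative f.num * f.denom - f.num * derivative f.denom) /
    algebraMap ℂ[X] (RatFunc ℂ) f.denom ^ 2

/-- The quotient rule holds for every representation of a rational function as a fraction. -/
theorem ratDeriv_div (p q : ℂ[X]) (hq : q ≠ 0) :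
    ratDeriv (algebraMap ℂ[X] (RatFunc ℂ) p / algebraMap ℂ[X] (RatFunc ℂ) q) =
      algebraMap ℂ[X] (RatFunc ℂ) (derivative p * q - p * derivative q) /
        algebraMap ℂ[X] (RatFunc ℂ) q ^ 2 := by
  have key : ∀ a b : ℂ[X], b ≠ 0 → a * q = p * b →
      algebraMap ℂ[X] (RatFunc ℂ) (derivative a * b - a * derivative b) /
          algebraMap ℂ[X] (RatFunc ℂ) b ^ 2 =
        algebraMap ℂ[X] (RatFunc ℂ) (derivative p * q - p * derivative q) /
          algebraMap ℂ[X] (RatFunc ℂ) q ^ 2 := by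
    intro a b hb h
    have h' := congrArg derivative h
    simp only [derivative_mul] at h'
    have e : (derivative a * b - a * derivative b) * q ^ 2 =
        (derivative p * q - p * derivative q) * b ^ 2 := by
      linear_combination (q * b) * h' - (derivative q * b + q * derivative b) * h
    rw [div_eq_div_iff (pow_ne_zero 2 (RatFunc.algebraMap_ne_zero hb))
      (pow_ne_zero 2 (RatFunc.algebraMap_ne_zero hq)), ← map_pow, ← map_pow, ← map_mul, ← map_mul,
      e]
  exact key _ _ (RatFunc.denom_ne_zero _) ((RatFunc.num_mul_eq_mul_denom_iff hq).2 rfl)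

/-- `d/dz ln f = f' / f` for a rational function `f`. -/
noncomputable def ratLogDeriv (f : RatFunc ℂ) : RatFunc ℂ := ratDeriv f / f

/-- `Q` is the sequence of polynomials `Q_n^{[3]}`: `Q_0 = 1`, every `Q_n` is monic, and for every
`n ≥ 1` the rational function `w(z; n) = d/dz ln (Q_{n-1} / Q_n)` solves the sixth-order equation
with parameter `α = n`. -/
def IsSpecialFamily (Q : ℕ → ℂ[X]) : Prop :=
  Q 0 = 1 ∧ (∀ n, (Q n).Monic) ∧
    ∀ n : ℕ, 1 ≤ n →
      sixthOrder ratDeriv RatFunc.X (n : RatFunc ℂ)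
        (ratLogDeriv (algebraMap ℂ[X] (RatFunc ℂ) (Q (n - 1)) /
          algebraMap ℂ[X] (RatFunc ℂ) (Q n))) = 0

/-- `s_m = ∑ a_k ^ m`, the sum over the complex roots of `P` counted with multiplicity. -/
noncomputable def rootPowerSum (P : ℂ[X]) (m : ℕ) : ℂ := (P.roots.map (fun a => a ^ m)).sum

/-- `d/dz` on formal Laurent series at `z = ∞`, that is, on Laurent series in the local
parameter `t = 1 / z`: it is `- t² d/dt`. -/
noncomputable def derivAtInfinity (W : LaurentSeries ℂ) : LaurentSeries ℂ :=
  -(HahnSeries.single 2 1 * LaurentSeries.derivative ℂ W)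

/-- The coefficient of `z ^ k` in a formal Laurent series in `t = 1 / z`. -/
def coeffAtInfinity (W : LaurentSeries ℂ) (k : ℤ) : ℂ := W.coeff (-k)

/-- `W` is a power expansion at infinity `∑_{m ≥ 0} c_{-(m+1)} z ^ (-m-1)` of a solution of the
sixth-order equation with parameter `α`: a formal series in `t = 1 / z` without constant term and
without positive powers of `z` that satisfies the equation, with `z = t⁻¹`. -/
def IsExpansionAtInfinity (α : ℂ) (W : LaurentSeries ℂ) : Prop :=
  (∀ k : ℤ, 0 ≤ k → coeffAtInfinity W k = 0) ∧
    sixthOrder derivAtInfinity (HahnSeries.single (-1) 1) (HahnSeries.C α) W = 0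

end PainleveTwo

/-! With `u = w' - w²` the equation reads `(d/dz + 2w) L₃[u] - zw - α = 0`, where `L₃` is `lenard`.
It is invariant under `(w, α) ↦ (-w, -α)`, and replacing `-w` by another function with the same
Miura potential gives the Bäcklund transformation `α ↦ α + 1` (`backlund_sixthOrder`).

Existence of the `Q_n`: starting from `w = 0` at `α = 0`, the transformation yields rational
solutions. That they are logarithmic derivatives of quotients of polynomials is the content of
`IsTauPair.exists_succ`. The pair `(P, Q) = (Q_{n-1}, Q_n)` carries Hirota's relation `Q''P - 2Q'P'
+ QP'' = 0`, and the next polynomial `S` satisfies `(S/P)' = (2n+1) Q²/P²`. The relation restricts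
the multiplicities of the roots of `P` and `Q` enough to make `S` a polynomial
(`denom_dvd_of_bilinear`); leading terms then make it monic of the right degree.

Expansions at infinity: for `t = 1/z` and `w = t g` the term `zw` is `g` itself, so the equation is
a fixed-point equation for `g`, contracting in the `t`-adic sense. It is equivariant under `t ↦ ζt`
with `ζ⁷ = 1`, so by uniqueness only exponents divisible by 7 survive.

Power sums: `P'/P = ∑ s_m z^(-m-1)`, hence uniqueness of the expansion gives `c_{n,-(m+1)} =
s_{n-1,m} - s_{n,m}`. Summation over `n` telescopes down to `Q_1 = z`. Since power sums determine a
monic polynomial, the same identity shows that the family is unique. -/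

namespace PainleveTwo

/-! ### Miura factorization and symmetries of the equation. -/

section DifferentialAlgebra

variable {R A : Type*} [CommRing R] [CommRing A] [Algebra R A]

/-- The third Lenard polynomial `L₃[u] = u⁗ + 10 u u'' + 5 u'² + 10 u³` of the KdV hierarchy. -/
def lenard (δ : A → A) (u : A) : A :=
  δ^[4] u + 10 * u * δ^[2] u + 5 * (δ u) ^ 2 + 10 * u ^ 3

theorem sixthOrder_eq_lenard (δ : Derivation R A A) (z α w : A) :
    sixthOrder δ z α w =
      δ (lenard δ (δ w - w ^ 2)) + 2 * w * lenard δ (δ w - w ^ 2) - z * w - α := by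
  have h5 : δ 5 = 0 := by exact_mod_cast δ.map_natCast 5
  have h10 : δ 10 = 0 := by exact_mod_cast δ.map_natCast 10
  simp only [sixthOrder, lenard, Function.iterate_succ_apply', Function.iterate_zero, id_eq,
    map_add, map_sub, Derivation.leibniz, smul_eq_mul, pow_succ, pow_zero, one_mul, h5, h10]
  ring

theorem sixthOrder_neg (δ : Derivation R A A) (z α w : A) :
    sixthOrder δ z (-α) (-w) = -sixthOrder δ z α w := by
  simp only [sixthOrder, Function.iterate_succ_apply', Function.iterate_zero, id_eq, map_neg]
  ring

theorem sixthOrder_map {B : Type*} [CommRing B] (φ : A →+* B) (δ : A → A) (δ' : B → B)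
    (h : ∀ a, δ' (φ a) = φ (δ a)) (z α w : A) :
    sixthOrder δ' (φ z) (φ α) (φ w) = φ (sixthOrder δ z α w) := by
  simp only [sixthOrder, Function.iterate_succ_apply', Function.iterate_zero, id_eq, h, map_add,
    map_sub, map_mul, map_pow, map_ofNat]

end DifferentialAlgebra

/-! ### Bäcklund transformation `α ↦ α + 1`. -/

section Backlund

variable {R K : Type*} [CommRing R] [Field K] [Algebra R K]

/-- The factored equation for `(-w, -α)`, rewritten as a first-order linear equation for the
denominator `Y` of the transformation. -/
theorem backlund_denominator (δ : Derivation R K K) {z α w : K} (hz : δ z = 1)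
    (h : sixthOrder δ z α w = 0) :
    δ (z - 2 * lenard δ (-δ w - w ^ 2)) - 2 * w * (z - 2 * lenard δ (-δ w - w ^ 2)) =
      2 * α + 1 := by
  have h' := sixthOrder_neg δ z α w
  rw [h, sixthOrder_eq_lenard, map_neg, neg_sq] at h'
  have h2 : δ 2 = 0 := by exact_mod_cast δ.map_natCast 2
  simp only [map_sub, Derivation.leibniz, smul_eq_mul, h2, hz]
  linear_combination -2 * h'

/-- The linear equation for `Y` is what makes `-w - c/Y` another solution of the Riccati equation
`v' - v² = u` already solved by `-w`; so `L₃[u]` does not change. -/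
theorem backlund_riccati (δ : Derivation R K K) {w Y c : K} (hY : Y ≠ 0) (hc : δ c = 0)
    (h : δ Y - 2 * w * Y = c) :
    δ (-w - c / Y) - (-w - c / Y) ^ 2 = -δ w - w ^ 2 := by
  have hd : δ (c / Y) * Y ^ 2 = -c * δ Y := by
    have h1 : δ (c / Y * Y) = 0 := by rw [div_mul_cancel₀ _ hY, hc]
    rw [Derivation.leibniz, smul_eq_mul, smul_eq_mul] at h1
    have h2 : c / Y * Y = c := div_mul_cancel₀ _ hY
    linear_combination Y * h1 - δ Y * h2
  rw [map_sub, map_neg]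
  have h3 : δ (c / Y) = -c * δ Y / Y ^ 2 := by
    rw [eq_div_iff (pow_ne_zero 2 hY), hd]
  rw [h3]
  field_simp
  linear_combination c * h

theorem backlund_sixthOrder (δ : Derivation R K K) {z α w : K} (hz : δ z = 1)
    (h : sixthOrder δ z α w = 0) (hα : δ α = 0)
    (hY : z - 2 * lenard δ (-δ w - w ^ 2) ≠ 0) :
    sixthOrder δ z (α + 1) (-w - (2 * α + 1) / (z - 2 * lenard δ (-δ w - w ^ 2))) = 0 := by
  have hd := backlund_denominator δ hz h
  have hc : δ (2 * α + 1) = 0 := by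
    have h2 : δ 2 = 0 := by exact_mod_cast δ.map_natCast 2
    simp [Derivation.leibniz, hα, h2]
  have hr := backlund_riccati δ hY hc hd
  rw [sixthOrder_eq_lenard, hr]
  have h' := sixthOrder_neg δ z α w
  rw [h, sixthOrder_eq_lenard, map_neg, neg_sq] at h'
  set l := lenard δ (-δ w - w ^ 2)
  have hq : (2 * α + 1) / (z - 2 * l) * (z - 2 * l) = 2 * α + 1 := div_mul_cancel₀ _ hY
  linear_combination h' + hq

end Backlund

/-! ### Root multiplicities under the bilinear relation. -/

section RootMultiplicity

variable {k : Type*} [Field k]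

theorem exists_eq_X_sub_C_pow_mul {P : k[X]} (hP : P ≠ 0) (a : k) :
    ∃ F : k[X], P = (X - C a) ^ P.rootMultiplicity a * F ∧ F.eval a ≠ 0 := by
  obtain ⟨F, h1, h2⟩ := exists_eq_pow_rootMultiplicity_mul_and_not_dvd P hP a
  exact ⟨F, h1, fun h => h2 (dvd_iff_isRoot.2 h)⟩

theorem X_sub_C_mul_derivative_pow_mul (a : k) (p : ℕ) (F : k[X]) :
    (X - C a) * derivative ((X - C a) ^ p * F) =
      (X - C a) ^ p * ((p : k[X]) * F + (X - C a) * derivative F) := by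
  rcases p with _ | p
  · simp
  · simp only [derivative_mul, derivative_X_sub_C_pow, Nat.add_sub_cancel, map_natCast]
    ring

theorem eq_of_X_sub_C_pow_mul_eq {a : k} {i j : ℕ} {F G : k[X]} (hF : F.eval a ≠ 0)
    (hG : G.eval a ≠ 0) (h : (X - C a) ^ i * F = (X - C a) ^ j * G) : i = j := by
  have hT : (X - C a : k[X]) ≠ 0 := X_sub_C_ne_zero a
  wlog hij : i ≤ j generalizing i j F G
  · exact (this hG hF h.symm (by omega)).symm
  by_contra hne
  obtain ⟨d, rfl⟩ : ∃ d, j = i + (d + 1) := ⟨j - i - 1, by omega⟩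
  rw [pow_add, mul_assoc] at h
  have h1 := mul_left_cancel₀ (pow_ne_zero i hT) h
  apply hF
  rw [h1]
  simp

/-- Roots of two polynomials in Hirota's bilinear relation have consecutive triangular
multiplicities. -/
theorem sq_sub_of_bilinear [CharZero k] {P Q : k[X]} (hP : P ≠ 0) (hQ : Q ≠ 0)
    (h : derivative (derivative Q) * P - 2 * derivative Q * derivative P +
      Q * derivative (derivative P) = 0) (a : k) :
    ((P.rootMultiplicity a : ℤ) - Q.rootMultiplicity a) ^ 2 =
      P.rootMultiplicity a + Q.rootMultiplicity a := by
  obtain ⟨F, hF, hFa⟩ := exists_eq_X_sub_C_pow_mul hP a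
  obtain ⟨G, hG, hGa⟩ := exists_eq_X_sub_C_pow_mul hQ a
  set q := P.rootMultiplicity a
  set p := Q.rootMultiplicity a
  have key : ∀ (U V : k[X]) (r : ℕ), U = (X - C a) ^ r * V → ∃ V₁ V₂ : k[X],
      (X - C a) * derivative U = (X - C a) ^ r * V₁ ∧
      (X - C a) ^ 2 * derivative (derivative U) = (X - C a) ^ r * V₂ ∧
      V₁.eval a = r * V.eval a ∧ V₂.eval a = r * (r - 1) * V.eval a := by
    intro U V r hU
    have h1 : (X - C a) * derivative U =
        (X - C a) ^ r * ((r : k[X]) * V + (X - C a) * derivative V) := by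
      rw [hU]; exact X_sub_C_mul_derivative_pow_mul a r V
    set V₁ := (r : k[X]) * V + (X - C a) * derivative V with hV₁
    have h2 := X_sub_C_mul_derivative_pow_mul a r V₁
    rw [← h1, derivative_mul, derivative_X_sub_C] at h2
    refine ⟨V₁, (r : k[X]) * V₁ + (X - C a) * derivative V₁ - V₁, h1, ?_, by simp [hV₁], ?_⟩
    · linear_combination h2 - h1
    · simp [hV₁]; ring
  obtain ⟨F₁, F₂, hF1, hF2, e1, e2⟩ := key P F q hF
  obtain ⟨G₁, G₂, hG1, hG2, e3, e4⟩ := key Q G p hG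
  -- After multiplication by `(X - a)²` every term contains `(X - a)^(p+q)`. The cofactor has the
  -- value `(p(p-1) - 2pq + q(q-1)) F(a) G(a)` at `a`.
  have hz : (X - C a) ^ (p + q) * (G₂ * F - 2 * G₁ * F₁ + G * F₂) = 0 := by
    have : (X - C a) ^ (p + q) * (G₂ * F - 2 * G₁ * F₁ + G * F₂) =
        ((X - C a) ^ p * G₂) * ((X - C a) ^ q * F) -
        2 * ((X - C a) ^ p * G₁) * ((X - C a) ^ q * F₁) +
        ((X - C a) ^ p * G) * ((X - C a) ^ q * F₂) := by ring
    rw [this, ← hF1, ← hF2, ← hG1, ← hG2, ← hF, ← hG]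
    linear_combination (X - C a) ^ 2 * h
  have hz' := (mul_eq_zero.1 hz).resolve_left (pow_ne_zero _ (X_sub_C_ne_zero a))
  have hev := congrArg (eval a) hz'
  simp only [eval_add, eval_sub, eval_mul, eval_ofNat, e1, e2, e3, e4, eval_zero] at hev
  have hfin : (((q : ℤ) - p) ^ 2 - (q + p) : ℤ) = 0 := by
    have : (((((q : ℤ) - p) ^ 2 - (q + p) : ℤ)) : k) * (F.eval a * G.eval a) = 0 := by
      push_cast
      linear_combination hev
    exact_mod_cast (mul_eq_zero.1 this).resolve_right (mul_ne_zero hFa hGa)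
  linarith

/-- A pole of `N/M` of order `m > 0` becomes a pole of order exactly `m + 1` of its derivative `c
Q²/P²`. -/
theorem rootMultiplicity_denom [CharZero k] {N M P Q : k[X]} (hP : P ≠ 0) (hQ : Q ≠ 0)
    (hM : M ≠ 0) (hNM : IsCoprime N M) {c : k} (hc : c ≠ 0)
    (h : (derivative N * M - N * derivative M) * P ^ 2 = C c * Q ^ 2 * M ^ 2) {a : k}
    (ha : 0 < M.rootMultiplicity a) :
    M.rootMultiplicity a + 2 * Q.rootMultiplicity a + 1 = 2 * P.rootMultiplicity a := by
  obtain ⟨F, hF, hFa⟩ := exists_eq_X_sub_C_pow_mul hP a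
  obtain ⟨G, hG, hGa⟩ := exists_eq_X_sub_C_pow_mul hQ a
  obtain ⟨H, hH, hHa⟩ := exists_eq_X_sub_C_pow_mul hM a
  set q := P.rootMultiplicity a
  set p := Q.rootMultiplicity a
  set m := M.rootMultiplicity a
  have hMa : M.eval a = 0 := by
    rw [hH]; simp [show m ≠ 0 by omega]
  have hNa : N.eval a ≠ 0 := by
    intro hN
    obtain ⟨u, v, huv⟩ := hNM
    have := congrArg (eval a) huv
    simp [hN, hMa] at this
  have hd := X_sub_C_mul_derivative_pow_mul a m H
  rw [← hH] at hd
  have e : (X - C a) ^ (m + 2 * q) * (((X - C a) * derivative N * H -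
        N * ((m : k[X]) * H + (X - C a) * derivative H)) * F ^ 2) =
      (X - C a) ^ (1 + 2 * p + 2 * m) * (C c * G ^ 2 * H ^ 2) := by
    have h1 : (X - C a) ^ (m + 2 * q) * (((X - C a) * derivative N * H -
        N * ((m : k[X]) * H + (X - C a) * derivative H)) * F ^ 2) =
      ((X - C a) * derivative N * ((X - C a) ^ m * H) -
        N * ((X - C a) ^ m * ((m : k[X]) * H + (X - C a) * derivative H))) *
        ((X - C a) ^ q * F) ^ 2 := by ring
    have h2 : (X - C a) ^ (1 + 2 * p + 2 * m) * (C c * G ^ 2 * H ^ 2) =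
      (X - C a) * (C c * ((X - C a) ^ p * G) ^ 2 * ((X - C a) ^ m * H) ^ 2) := by ring
    rw [h1, h2, ← hF, ← hG, ← hH, ← hd]
    linear_combination (X - C a) * h
  have := eq_of_X_sub_C_pow_mul_eq ?_ ?_ e
  · omega
  · have hm : (m : k) ≠ 0 := by exact_mod_cast ha.ne'
    simp [hNa, hm, hHa, hFa]
  · simp [hc, hGa, hHa]

/-- If `P`, `Q` are in Hirota's bilinear relation, then a rational primitive of `c Q² / P²` has a
denominator that divides `P`. -/
theorem denom_dvd_of_bilinear [IsAlgClosed k] [CharZero k] {N M P Q : k[X]} (hP : P ≠ 0)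
    (hQ : Q ≠ 0) (hM : M ≠ 0) (hNM : IsCoprime N M) {c : k} (hc : c ≠ 0)
    (hbil : derivative (derivative Q) * P - 2 * derivative Q * derivative P +
      Q * derivative (derivative P) = 0)
    (h : (derivative N * M - N * derivative M) * P ^ 2 = C c * Q ^ 2 * M ^ 2) : M ∣ P := by
  classical
  rw [IsAlgClosed.dvd_iff_roots_le_roots hM hP, Multiset.le_iff_count]
  intro a
  rw [count_roots, count_roots]
  rcases Nat.eq_zero_or_pos (M.rootMultiplicity a) with h0 | h0
  · omega
  have h1 := rootMultiplicity_denom hP hQ hM hNM hc h h0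
  have h2 := sq_sub_of_bilinear hP hQ hbil a
  have h3 : (M.rootMultiplicity a : ℤ) =
      2 * ((P.rootMultiplicity a : ℤ) - Q.rootMultiplicity a) - 1 := by omega
  have h4 : 0 < (P.rootMultiplicity a : ℤ) - Q.rootMultiplicity a := by omega
  zify
  generalize (P.rootMultiplicity a : ℤ) = x at *
  generalize (Q.rootMultiplicity a : ℤ) = y at *
  rw [h3]
  -- For `d = x - y`, `d² = x + y` gives `2x = d² + d`. The claim `2d - 1 ≤ x` is then `(d-1)(d-2) ≥
  -- 0`, true for every integer `d`.
  have h5 : 0 ≤ (x - y - 1) * (x - y - 2) := by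
    rcases le_or_gt (x - y) 1 with h6 | h6
    · exact mul_nonneg_of_nonpos_of_nonpos (by omega) (by omega)
    · exact mul_nonneg (by omega) (by omega)
  linarith [h5, h2, show (x - y - 1) * (x - y - 2) = (x - y) ^ 2 - 3 * (x - y) + 2 by ring]

end RootMultiplicity

/-- The Euler operator `X d/dX` keeps the degree bound, so leading coefficients can be compared
without separating constants. -/
theorem X_mul_derivative_coeff_natDegree {k : Type*} [Field k] (F : k[X]) :
    (X * derivative F).natDegree ≤ F.natDegree ∧
      (X * derivative F).coeff F.natDegree = F.natDegree * F.leadingCoeff := by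
  rcases Nat.eq_zero_or_pos F.natDegree with h0 | h0
  · have : derivative F = 0 := by rw [eq_C_of_natDegree_eq_zero h0, derivative_C]
    simp [this, h0]
  · constructor
    · refine natDegree_mul_le.trans ?_
      have := natDegree_derivative_lt (p := F) h0.ne'
      rw [natDegree_X]
      omega
    · obtain ⟨d, hd⟩ : ∃ d, F.natDegree = d + 1 := ⟨F.natDegree - 1, by omega⟩
      rw [leadingCoeff, hd, coeff_X_mul, coeff_derivative]
      push_cast
      ring

/-- A nonzero difference `D = P - Q` would satisfy `D'Q = DQ'`, whose leading coefficients force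
`deg D = deg Q`; but the leading terms of `P` and `Q` cancel in `D`. -/
theorem eq_of_derivative_mul_eq {k : Type*} [Field k] [CharZero k] {P Q : k[X]} (hP : P.Monic)
    (hQ : Q.Monic) (hd : P.natDegree = Q.natDegree)
    (h : derivative P * Q = P * derivative Q) : P = Q := by
  by_contra hne
  have hD : P - Q ≠ 0 := sub_ne_zero.2 hne
  have hlt : (P - Q).natDegree < Q.natDegree := by
    refine natDegree_lt_natDegree hD ?_
    rw [← neg_sub, degree_neg]
    exact degree_sub_lt_left (by rw [degree_eq_natDegree hP.ne_zero, degree_eq_natDegree hQ.ne_zero, hd])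
      hQ.ne_zero (by rw [hP.leadingCoeff, hQ.leadingCoeff])
  have h' : (X * derivative (P - Q)) * Q = (P - Q) * (X * derivative Q) := by
    rw [derivative_sub]
    linear_combination X * h
  have hco := congrArg (fun F => coeff F ((P - Q).natDegree + Q.natDegree)) h'
  have h1 := X_mul_derivative_coeff_natDegree (P - Q)
  have h2 := X_mul_derivative_coeff_natDegree Q
  simp only [coeff_mul_add_eq_of_natDegree_le h1.1 le_rfl,
    coeff_mul_add_eq_of_natDegree_le le_rfl h2.1, h1.2, h2.2, hQ.coeff_natDegree,
    hQ.leadingCoeff, coeff_natDegree, mul_one] at hco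
  rw [mul_comm] at hco
  exact hlt.ne (by exact_mod_cast mul_left_cancel₀ (leadingCoeff_ne_zero.2 hD) hco)

/-- Leading terms give `deg S + deg P = 2 deg Q + 1` and `(deg S - deg P) lc(S) = 2n + 1`, once `deg
S ≠ deg P` excludes cancellation. -/
theorem monic_of_wronskian {k : Type*} [Field k] [CharZero k] {n : ℕ} {P Q S : k[X]}
    (hP : P.Monic) (hQ : Q.Monic) (hPd : 2 * P.natDegree + n = n * n)
    (hQd : 2 * Q.natDegree = n * n + n)
    (h : derivative S * P - S * derivative P = C (2 * (n : k) + 1) * Q ^ 2) :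
    S.Monic ∧ 2 * S.natDegree = (n + 1) * (n + 1) + (n + 1) := by
  have hc : (2 * (n : k) + 1) ≠ 0 := by exact_mod_cast (by omega : 2 * n + 1 ≠ 0)
  have hXd : ∀ F : k[X], _ := X_mul_derivative_coeff_natDegree
  have h' : (X * derivative S) * P - S * (X * derivative P) = C (2 * (n : k) + 1) * (X * Q ^ 2) := by
    linear_combination X * h
  have hco := congrArg (fun F => coeff F (S.natDegree + P.natDegree)) h'
  simp only [coeff_sub, coeff_mul_add_eq_of_natDegree_le (hXd S).1 le_rfl,
    coeff_mul_add_eq_of_natDegree_le le_rfl (hXd P).1, (hXd S).2, (hXd P).2, coeff_C_mul] at hco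
  have hXQ : (X * Q ^ 2).Monic := monic_X.mul (hQ.pow 2)
  have hXQd : (X * Q ^ 2).natDegree = 2 * Q.natDegree + 1 := by
    rw [monic_X.natDegree_mul (hQ.pow 2), natDegree_X, hQ.natDegree_pow]; omega
  have hle : 2 * Q.natDegree + 1 ≤ S.natDegree + P.natDegree := by
    rw [← hXQd, ← natDegree_C_mul hc, ← h']
    refine (natDegree_sub_le _ _).trans (max_le ?_ ?_)
    · exact natDegree_mul_le.trans (Nat.add_le_add_right (hXd S).1 _)
    · exact natDegree_mul_le.trans (Nat.add_le_add_left (hXd P).1 _)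
  have hlc : P.coeff P.natDegree = 1 := hP
  rw [hlc, hP.leadingCoeff] at hco
  have hS0 : S ≠ 0 := by
    rintro rfl
    simp only [derivative_zero, mul_zero, zero_mul, sub_zero] at h'
    exact mul_ne_zero (C_ne_zero.2 hc) hXQ.ne_zero h'.symm
  have hne : ((S.natDegree : k) - P.natDegree) ≠ 0 := by
    rw [sub_ne_zero]
    exact_mod_cast (by nlinarith : S.natDegree ≠ P.natDegree)
  have hge : S.natDegree + P.natDegree ≤ 2 * Q.natDegree + 1 := by
    by_contra hlt
    have hz : (X * Q ^ 2).coeff (S.natDegree + P.natDegree) = 0 :=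
      coeff_eq_zero_of_natDegree_lt (by omega)
    rw [hz] at hco
    refine mul_ne_zero hne (leadingCoeff_ne_zero.2 hS0) ?_
    rw [leadingCoeff] at hco ⊢
    linear_combination hco
  have heq : S.natDegree + P.natDegree = 2 * Q.natDegree + 1 := le_antisymm hge hle
  have hdeg : 2 * S.natDegree = (n + 1) * (n + 1) + (n + 1) := by nlinarith
  refine ⟨?_, hdeg⟩
  have hdiff : S.natDegree = P.natDegree + (2 * n + 1) := by nlinarith
  rw [heq, ← hXQd, hXQ.coeff_natDegree, hdiff] at hco
  push_cast at hco
  rw [Monic]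
  refine mul_left_cancel₀ hc ?_
  rw [leadingCoeff] at hco ⊢
  rw [hdiff] at hco ⊢
  linear_combination hco

/-! ### Recursive construction of the polynomials. -/

section RationalFunctions

local notation "ι" => algebraMap ℂ[X] (RatFunc ℂ)

theorem exists_eq_algebraMap_div (f : RatFunc ℂ) : ∃ p q : ℂ[X], q ≠ 0 ∧ f = ι p / ι q :=
  ⟨f.num, f.denom, f.denom_ne_zero, f.num_div_denom.symm⟩

theorem ratDeriv_algebraMap (p : ℂ[X]) : ratDeriv (ι p) = ι (derivative p) := by
  simpa using ratDeriv_div p 1 one_ne_zero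

theorem ratDeriv_add (f g : RatFunc ℂ) : ratDeriv (f + g) = ratDeriv f + ratDeriv g := by
  obtain ⟨p, q, hq, rfl⟩ := exists_eq_algebraMap_div f
  obtain ⟨r, s, hs, rfl⟩ := exists_eq_algebraMap_div g
  have hq' := RatFunc.algebraMap_ne_zero hq
  have hs' := RatFunc.algebraMap_ne_zero hs
  rw [div_add_div _ _ hq' hs', ← map_mul, ← map_mul, ← map_mul, ← map_add,
    ratDeriv_div _ _ (mul_ne_zero hq hs), ratDeriv_div _ _ hq, ratDeriv_div _ _ hs]
  simp only [derivative_mul, map_add, map_sub, map_mul]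
  field_simp
  ring

theorem ratDeriv_mul (f g : RatFunc ℂ) : ratDeriv (f * g) = f * ratDeriv g + g * ratDeriv f := by
  obtain ⟨p, q, hq, rfl⟩ := exists_eq_algebraMap_div f
  obtain ⟨r, s, hs, rfl⟩ := exists_eq_algebraMap_div g
  have hq' := RatFunc.algebraMap_ne_zero hq
  have hs' := RatFunc.algebraMap_ne_zero hs
  rw [div_mul_div_comm, ← map_mul, ← map_mul,
    ratDeriv_div _ _ (mul_ne_zero hq hs), ratDeriv_div _ _ hq, ratDeriv_div _ _ hs]
  simp only [derivative_mul, map_add, map_sub, map_mul]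
  field_simp
  ring

/-- `d/dz` as a derivation of the field of rational functions. -/
noncomputable def ratDerivation : Derivation ℂ (RatFunc ℂ) (RatFunc ℂ) :=
  Derivation.mk'
    { toFun := ratDeriv
      map_add' := ratDeriv_add
      map_smul' := fun c f => by
        rw [Algebra.smul_def, IsScalarTower.algebraMap_apply ℂ ℂ[X] (RatFunc ℂ), ratDeriv_mul,
          ratDeriv_algebraMap, Polynomial.algebraMap_eq, derivative_C, map_zero, mul_zero, add_zero,
          RingHom.id_apply, Algebra.smul_def, IsScalarTower.algebraMap_apply ℂ ℂ[X] (RatFunc ℂ),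
          Polynomial.algebraMap_eq] }
    ratDeriv_mul

theorem coe_ratDerivation : ⇑ratDerivation = ratDeriv := rfl

theorem ratDeriv_X : ratDeriv RatFunc.X = 1 := by
  rw [← RatFunc.algebraMap_X, ratDeriv_algebraMap, derivative_X, map_one]

theorem ratLogDeriv_div {p q : ℂ[X]} (hp : p ≠ 0) (hq : q ≠ 0) :
    ratLogDeriv (ι p / ι q) = ι (derivative p) / ι p - ι (derivative q) / ι q := by
  have hp' := RatFunc.algebraMap_ne_zero hp
  have hq' := RatFunc.algebraMap_ne_zero hq
  rw [ratLogDeriv, ratDeriv_div _ _ hq]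
  simp only [map_sub, map_mul]
  field_simp

/-- The consecutive pairs `(Q_{n-1}, Q_n)` in the recursive construction. -/
structure IsTauPair (n : ℕ) (P Q : ℂ[X]) : Prop where
  monic_left : P.Monic
  monic_right : Q.Monic
  natDegree_left : 2 * P.natDegree + n = n * n
  natDegree_right : 2 * Q.natDegree = n * n + n
  bilinear : derivative (derivative Q) * P - 2 * derivative Q * derivative P +
    Q * derivative (derivative P) = 0
  sixthOrder_eq_zero :
    sixthOrder ratDeriv RatFunc.X (n : RatFunc ℂ) (ratLogDeriv (ι P / ι Q)) = 0

/-- The recursion starts from the convention `Q_{-1} = 1`, that is, from `w = 0`. -/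
theorem isTauPair_zero : IsTauPair 0 1 1 where
  monic_left := monic_one
  monic_right := monic_one
  natDegree_left := by simp
  natDegree_right := by simp
  bilinear := by simp
  sixthOrder_eq_zero := by
    rw [ratLogDeriv_div one_ne_zero one_ne_zero, sub_self, ← coe_ratDerivation, Nat.cast_zero,
      sixthOrder_eq_lenard]
    simp only [lenard, Function.iterate_succ_apply', Function.iterate_zero, id_eq, map_zero,
      ne_eq, OfNat.ofNat_ne_zero, not_false_eq_true, zero_pow, mul_zero, sub_zero, add_zero]

theorem exists_polynomial_primitive {P Q : ℂ[X]} (hP : P ≠ 0) (hQ : Q ≠ 0) {c : ℂ} (hc : c ≠ 0)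
    (hbil : derivative (derivative Q) * P - 2 * derivative Q * derivative P +
      Q * derivative (derivative P) = 0) {R : RatFunc ℂ}
    (hR : ratDeriv R = ι (C c) * ι Q ^ 2 / ι P ^ 2) :
    ∃ S : ℂ[X], R = ι S / ι P ∧ derivative S * P - S * derivative P = C c * Q ^ 2 := by
  have hP' := RatFunc.algebraMap_ne_zero hP
  have hM := R.denom_ne_zero
  have hM' := RatFunc.algebraMap_ne_zero hM
  have h : (derivative R.num * R.denom - R.num * derivative R.denom) * P ^ 2 =
      C c * Q ^ 2 * R.denom ^ 2 := by
    rw [ratDeriv, div_eq_div_iff (pow_ne_zero 2 hM') (pow_ne_zero 2 hP')] at hR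
    apply RatFunc.algebraMap_injective ℂ
    simpa only [map_mul, map_pow] using hR
  obtain ⟨D, hD⟩ := denom_dvd_of_bilinear hP hQ hM R.isCoprime_num_denom hc hbil h
  have hRS : R = ι (R.num * D) / ι P := by
    conv_lhs => rw [← R.num_div_denom]
    rw [div_eq_div_iff hM' hP', ← map_mul, ← map_mul]
    congr 1
    conv_lhs => rw [hD]
    ring
  refine ⟨R.num * D, hRS, ?_⟩
  rw [hRS, ratDeriv_div _ _ hP, div_left_inj' (pow_ne_zero 2 hP')] at hR
  apply RatFunc.algebraMap_injective ℂ
  simpa only [map_mul, map_pow] using hR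

/-- For `w = (ln p/q)'` the bilinear relation yields `-w' - w² = 2 (ln q)''`. Together with
`bilinear_of_riccati`, a converse for the other sign, it carries the relation from `(P, Q)` to `(Q,
S)`, since the Bäcklund transformation preserves this potential. -/
theorem neg_riccati_of_bilinear {K : Type*} [Field K] {p p₁ p₂ q q₁ q₂ w w₁ : K} (hp : p ≠ 0)
    (hq : q ≠ 0) (hbil : q₂ * p - 2 * q₁ * p₁ + q * p₂ = 0) (hw : w = p₁ / p - q₁ / q)
    (hw₁ : w₁ = (p₂ * p - p₁ * p₁) / p ^ 2 - (q₂ * q - q₁ * q₁) / q ^ 2) :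
    -w₁ - w ^ 2 = 2 * ((q₂ * q - q₁ * q₁) / q ^ 2) := by
  rw [hw, hw₁]
  field_simp
  linear_combination (-p * q) * hbil

theorem bilinear_of_riccati {K : Type*} [Field K] {p p₁ p₂ q q₁ q₂ w w₁ : K} (hp : p ≠ 0)
    (hq : q ≠ 0) (hw : w = p₁ / p - q₁ / q)
    (hw₁ : w₁ = (p₂ * p - p₁ * p₁) / p ^ 2 - (q₂ * q - q₁ * q₁) / q ^ 2)
    (h : w₁ - w ^ 2 = 2 * ((p₂ * p - p₁ * p₁) / p ^ 2)) :
    q₂ * p - 2 * q₁ * p₁ + q * p₂ = 0 := by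
  rw [hw, hw₁] at h
  field_simp at h
  have h' : p * q * (q₂ * p - 2 * q₁ * p₁ + q * p₂) = 0 := by linear_combination -h
  exact (mul_eq_zero.1 h').resolve_left (mul_ne_zero hp hq)

theorem ratDeriv_ratLogDeriv_div {p q : ℂ[X]} (hp : p ≠ 0) (hq : q ≠ 0) :
    ratDeriv (ratLogDeriv (ι p / ι q)) =
      (ι (derivative (derivative p)) * ι p - ι (derivative p) * ι (derivative p)) / ι p ^ 2 -
      (ι (derivative (derivative q)) * ι q - ι (derivative q) * ι (derivative q)) / ι q ^ 2 := by
  rw [ratLogDeriv_div hp hq, ← coe_ratDerivation, map_sub, coe_ratDerivation, ratDeriv_div _ _ hp,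
    ratDeriv_div _ _ hq]
  simp only [map_sub, map_mul]

theorem IsTauPair.exists_succ {n : ℕ} {P Q : ℂ[X]} (h : IsTauPair n P Q) :
    ∃ S, IsTauPair (n + 1) Q S := by
  have hP := h.monic_left.ne_zero
  have hQ := h.monic_right.ne_zero
  have hP' := RatFunc.algebraMap_ne_zero hP
  have hQ' := RatFunc.algebraMap_ne_zero hQ
  have hc : (2 * (n : ℂ) + 1) ≠ 0 := by exact_mod_cast (by omega : 2 * n + 1 ≠ 0)
  have hιc : ι (C (2 * (n : ℂ) + 1)) = 2 * (n : RatFunc ℂ) + 1 := by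
    simp only [map_add, map_mul, map_natCast, map_ofNat, map_one]
  have hc' : (2 * (n : RatFunc ℂ) + 1) ≠ 0 := by
    rw [← hιc]; exact RatFunc.algebraMap_ne_zero (C_ne_zero.2 hc)
  set w := ratLogDeriv (ι P / ι Q) with hw
  have hwe := ratLogDeriv_div hP hQ
  rw [← hw] at hwe
  have hw₁ := ratDeriv_ratLogDeriv_div hP hQ
  rw [← hw] at hw₁
  have hode := h.sixthOrder_eq_zero
  rw [← hw, ← coe_ratDerivation] at hode
  have hX : ratDerivation RatFunc.X = 1 := ratDeriv_X
  have hY := backlund_denominator ratDerivation hX hode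
  have hν : ratDerivation (n : RatFunc ℂ) = 0 := ratDerivation.map_natCast n
  have hY0 : RatFunc.X - 2 * lenard ratDerivation (-ratDerivation w - w ^ 2) ≠ 0 := by
    intro h0
    rw [h0, map_zero, mul_zero, sub_zero] at hY
    exact hc' hY.symm
  have hode' := backlund_sixthOrder ratDerivation hX hode hν hY0
  have hδc : ratDerivation (2 * (n : RatFunc ℂ) + 1) = 0 := by
    rw [← hιc, coe_ratDerivation, ratDeriv_algebraMap, derivative_C, map_zero]
  have hricc := backlund_riccati ratDerivation hY0 hδc hY
  set Y := RatFunc.X - 2 * lenard ratDerivation (-ratDerivation w - w ^ 2)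
  -- As `w = (ln P/Q)'`, the factor `Q²/P²` is an integrating factor of `Y' - 2wY = 2n + 1`.
  have hR : ratDeriv (Y * ι Q ^ 2 / ι P ^ 2) =
      ι (C (2 * (n : ℂ) + 1)) * ι Q ^ 2 / ι P ^ 2 := by
    rw [hιc, ← hY, ← coe_ratDerivation, Derivation.leibniz_div, pow_two (ι Q), pow_two (ι P)]
    simp only [Derivation.leibniz, smul_eq_mul]
    rw [coe_ratDerivation, ratDeriv_algebraMap, ratDeriv_algebraMap, hwe]
    field_simp
    ring
  obtain ⟨S, hRS, hW⟩ := exists_polynomial_primitive hP hQ hc h.bilinear hR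
  obtain ⟨hSm, hSd⟩ :=
    monic_of_wronskian h.monic_left h.monic_right h.natDegree_left h.natDegree_right hW
  have hS := hSm.ne_zero
  have hS' := RatFunc.algebraMap_ne_zero hS
  -- Here `Y = SP/Q²`, so `(2n+1)/Y = S'/S - P'/P` by the Wronskian identity `hW`.
  have hv : ratLogDeriv (ι Q / ι S) = -w - (2 * (n : RatFunc ℂ) + 1) / Y := by
    have hSY : ι S * ι P = Y * ι Q ^ 2 := by
      rw [div_eq_div_iff (pow_ne_zero 2 hP') hP'] at hRS
      refine mul_right_cancel₀ hP' ?_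
      linear_combination -hRS
    have hWι := congrArg ι hW
    simp only [map_sub, map_mul, map_pow] at hWι
    rw [hιc] at hWι
    have hYe : Y = ι S * ι P / ι Q ^ 2 := by rw [hSY]; field_simp
    rw [ratLogDeriv_div hQ hS, hwe, hYe]
    field_simp
    linear_combination (-ι Q) * hWι
  have hbilι := congrArg ι h.bilinear
  simp only [map_add, map_sub, map_mul, map_ofNat, map_zero] at hbilι
  refine ⟨S, h.monic_right, hSm, ?_, hSd, ?_, ?_⟩
  · have := h.natDegree_right
    linarith [show (n + 1) * (n + 1) = n * n + n + (n + 1) by ring]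
  · rw [← hv, coe_ratDerivation, neg_riccati_of_bilinear hP' hQ' hbilι hwe hw₁] at hricc
    have := bilinear_of_riccati hQ' hS' (ratLogDeriv_div hQ hS) (ratDeriv_ratLogDeriv_div hQ hS)
      hricc
    apply RatFunc.algebraMap_injective ℂ
    simpa only [map_add, map_sub, map_mul, map_ofNat, map_zero] using this
  · rw [hv, Nat.cast_add_one]
    exact hode'

theorem exists_isSpecialFamily :
    ∃ Q : ℕ → ℂ[X], IsSpecialFamily Q ∧ ∀ n, 2 * (Q n).natDegree = n * n + n := by
  let f : ∀ n, {x : ℂ[X] × ℂ[X] // IsTauPair n x.1 x.2} := fun n =>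
    Nat.rec ⟨(1, 1), isTauPair_zero⟩
      (fun _ x => ⟨(x.1.2, x.2.exists_succ.choose), x.2.exists_succ.choose_spec⟩) n
  refine ⟨fun n => (f n).1.2, ⟨rfl, fun n => (f n).2.monic_right, ?_⟩,
    fun n => (f n).2.natDegree_right⟩
  intro n hn
  obtain ⟨m, rfl⟩ : ∃ m, n = m + 1 := ⟨n - 1, by omega⟩
  exact (f (m + 1)).2.sixthOrder_eq_zero

end RationalFunctions

/-! ### Formal solutions as fixed points, and their symmetry of order 7. -/

section PowerSeriesSolutions

open PowerSeries (rescale coeff_rescale)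

/-- Banach's fixed-point argument for the `X`-adic topology: each iteration from `0` settles one
more coefficient. -/
theorem existsUnique_fixedPoint_of_X_pow_dvd {R : Type*} [CommRing R]
    (F : PowerSeries R → PowerSeries R)
    (hF : ∀ (k : ℕ) (f g : PowerSeries R), PowerSeries.X ^ k ∣ f - g →
      PowerSeries.X ^ (k + 1) ∣ F f - F g) : ∃! g, F g = g := by
  have hzero : ∀ f : PowerSeries R, (∀ n : ℕ, PowerSeries.X ^ n ∣ f) → f = 0 := by
    intro f hf
    ext n
    exact PowerSeries.X_pow_dvd_iff.1 (hf (n + 1)) n n.lt_succ_self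
  have hstep : ∀ n : ℕ, (PowerSeries.X : PowerSeries R) ^ n ∣ F^[n + 1] 0 - F^[n] 0 := by
    intro n
    induction n with
    | zero => simp
    | succ n ih =>
      simpa only [Function.iterate_succ_apply'] using hF n _ _ ih
  have hcauchy : ∀ n m : ℕ, (PowerSeries.X : PowerSeries R) ^ n ∣ F^[n + m] 0 - F^[n] 0 := by
    intro n m
    induction m with
    | zero => simp
    | succ m ih =>
      have := dvd_add (dvd_trans (pow_dvd_pow _ (Nat.le_add_right n m)) (hstep (n + m))) ih
      rwa [sub_add_sub_cancel] at this
  let g : PowerSeries R := PowerSeries.mk fun m => PowerSeries.coeff m (F^[m + 1] 0)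
  have hg : ∀ n : ℕ, PowerSeries.X ^ n ∣ g - F^[n] 0 := by
    intro n
    rw [PowerSeries.X_pow_dvd_iff]
    intro m hm
    obtain ⟨d, rfl⟩ : ∃ d, n = m + 1 + d := ⟨n - (m + 1), by omega⟩
    have := PowerSeries.X_pow_dvd_iff.1 (hcauchy (m + 1) d) m m.lt_succ_self
    rw [map_sub, sub_eq_zero] at this
    rw [map_sub, PowerSeries.coeff_mk, this, sub_self]
  have hfg : F g = g := by
    rw [← sub_eq_zero]
    refine hzero _ fun n => ?_
    have h1 := hF n _ _ (hg n)
    rw [← Function.iterate_succ_apply' F n] at h1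
    have h2 := dvd_sub h1 (hg (n + 1))
    rw [sub_sub_sub_cancel_right] at h2
    exact dvd_trans (pow_dvd_pow _ n.le_succ) h2
  refine ⟨g, hfg, fun f hf => ?_⟩
  rw [← sub_eq_zero]
  refine hzero _ fun n => ?_
  induction n with
  | zero => simp
  | succ n ih =>
    have := hF n _ _ ih
    rwa [hf, hfg] at this

/-- `d/dz = - t² d/dt` on power series in `t = 1 / z`. -/
noncomputable def tDeriv (f : PowerSeries ℂ) : PowerSeries ℂ :=
  -(PowerSeries.X ^ 2 * PowerSeries.derivative ℂ f)

/-- The part of the sixth-order equation that does not involve `z`, at `w = t g`. -/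
noncomputable def autonomousPart (g : PowerSeries ℂ) : PowerSeries ℂ :=
  sixthOrder tDeriv 0 0 (PowerSeries.X * g)

theorem X_pow_dvd_tDeriv_sub {n : ℕ} {f g : PowerSeries ℂ} (h : PowerSeries.X ^ n ∣ f - g) :
    PowerSeries.X ^ n ∣ tDeriv f - tDeriv g := by
  obtain ⟨r, hr⟩ := h
  have hd := congrArg (PowerSeries.derivative ℂ) hr
  rw [map_sub, Derivation.leibniz, smul_eq_mul, smul_eq_mul, PowerSeries.derivative_pow,
    PowerSeries.derivative_X] at hd
  rcases n with _ | n
  · simp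
  refine ⟨-(PowerSeries.X ^ 2 * PowerSeries.derivative ℂ r +
    PowerSeries.X * (r * ((n + 1 : ℕ) : PowerSeries ℂ))), ?_⟩
  rw [Nat.add_sub_cancel] at hd
  rw [tDeriv, tDeriv]
  linear_combination (-PowerSeries.X ^ 2) * hd

theorem X_pow_dvd_autonomousPart_sub {k : ℕ} {f g : PowerSeries ℂ}
    (h : PowerSeries.X ^ k ∣ f - g) :
    PowerSeries.X ^ (k + 1) ∣ autonomousPart f - autonomousPart g := by
  have h0 : PowerSeries.X ^ (k + 1) ∣ PowerSeries.X * f - PowerSeries.X * g := by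
    rw [← mul_sub, pow_succ']
    exact mul_dvd_mul_left _ h
  have hi : ∀ i : ℕ, PowerSeries.X ^ (k + 1) ∣
      tDeriv^[i] (PowerSeries.X * f) - tDeriv^[i] (PowerSeries.X * g) := by
    intro i
    induction i with
    | zero => exact h0
    | succ i ih =>
      rw [Function.iterate_succ_apply', Function.iterate_succ_apply']
      exact X_pow_dvd_tDeriv_sub ih
  -- Congruence modulo `X^(k+1)` becomes equality in a quotient ring, where a polynomial in `w` and
  -- its derivatives respects it.
  have hq : ∀ a b : PowerSeries ℂ, PowerSeries.X ^ (k + 1) ∣ a - b ↔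
      Ideal.Quotient.mk (Ideal.span {(PowerSeries.X : PowerSeries ℂ) ^ (k + 1)}) a =
      Ideal.Quotient.mk (Ideal.span {(PowerSeries.X : PowerSeries ℂ) ^ (k + 1)}) b := by
    intro a b
    rw [Ideal.Quotient.mk_eq_mk_iff_sub_mem, Ideal.mem_span_singleton]
  have h1 := hi 1
  rw [Function.iterate_one] at h1
  rw [hq] at h0 h1 ⊢
  simp only [hq] at hi
  rw [autonomousPart, autonomousPart]
  generalize PowerSeries.X * f = u at *
  generalize PowerSeries.X * g = v at *
  simp only [sixthOrder, map_sub, map_add, map_mul, map_pow, hi, h1, h0]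

theorem existsUnique_autonomousPart_sub (α : ℂ) :
    ∃! g : PowerSeries ℂ, autonomousPart g - PowerSeries.C α = g := by
  refine existsUnique_fixedPoint_of_X_pow_dvd (fun g => autonomousPart g - PowerSeries.C α) ?_
  intro k f g h
  rw [sub_sub_sub_cancel_right]
  exact X_pow_dvd_autonomousPart_sub h

theorem tDeriv_C_mul (c : ℂ) (f : PowerSeries ℂ) :
    tDeriv (PowerSeries.C c * f) = PowerSeries.C c * tDeriv f := by
  rw [tDeriv, tDeriv, Derivation.leibniz, PowerSeries.derivative_C, smul_eq_mul, smul_zero,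
    add_zero]
  ring

theorem derivative_rescale (a : ℂ) (f : PowerSeries ℂ) :
    PowerSeries.derivative ℂ (rescale a f) =
      PowerSeries.C a * rescale a (PowerSeries.derivative ℂ f) := by
  ext n
  rw [PowerSeries.coeff_derivative, coeff_rescale, PowerSeries.coeff_C_mul, coeff_rescale,
    PowerSeries.coeff_derivative]
  ring

theorem tDeriv_rescale {a b : ℂ} (hab : b * a = 1) (f : PowerSeries ℂ) :
    tDeriv (rescale a f) = PowerSeries.C b * rescale a (tDeriv f) := by
  have h : (PowerSeries.C b * PowerSeries.C a : PowerSeries ℂ) = 1 := by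
    rw [← map_mul, hab, map_one]
  rw [tDeriv, tDeriv, derivative_rescale, map_neg, map_mul, map_pow, PowerSeries.rescale_X]
  linear_combination (PowerSeries.C a * PowerSeries.X ^ 2 *
    rescale a (PowerSeries.derivative ℂ f)) * h

/-- Give `w` and `d/dz` weight 1: every term without `z` and `α` then has weight 7. The scalar `a ^
6` is the inverse of `a`. -/
theorem autonomousPart_rescale {a : ℂ} (ha : a ^ 7 = 1) (g : PowerSeries ℂ) :
    autonomousPart (rescale a g) = rescale a (autonomousPart g) := by
  have hb : a ^ 6 * a = 1 := by rw [← pow_succ, ha]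
  have hC : (PowerSeries.C (a ^ 6) : PowerSeries ℂ) ^ 7 = 1 := by
    rw [← map_pow, ← pow_mul, mul_comm, pow_mul, ha, one_pow, map_one]
  have h0 : PowerSeries.X * rescale a g =
      PowerSeries.C (a ^ 6) * rescale a (PowerSeries.X * g) := by
    rw [map_mul, PowerSeries.rescale_X, ← mul_assoc, ← mul_assoc, ← map_mul, hb, map_one, one_mul]
  have h1 : sixthOrder tDeriv 0 0 (PowerSeries.X * rescale a g) =
      (PowerSeries.C (a ^ 6)) ^ 7 * rescale a (sixthOrder tDeriv 0 0 (PowerSeries.X * g)) := by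
    rw [h0]
    have hr := tDeriv_rescale hb
    have hm := tDeriv_C_mul (a ^ 6)
    generalize PowerSeries.X * g = w
    generalize PowerSeries.C (a ^ 6) = c at *
    simp only [sixthOrder, Function.iterate_succ_apply', Function.iterate_zero, id_eq,
      hm, hr, map_sub, map_add, map_mul, map_pow, map_ofNat, map_zero]
    ring
  rw [autonomousPart, h1, hC, one_mul, autonomousPart]

theorem coeff_eq_zero_of_autonomousPart_sub {α : ℂ} {g : PowerSeries ℂ}
    (hg : autonomousPart g - PowerSeries.C α = g) {m : ℕ} (hm : ¬ 7 ∣ m) :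
    PowerSeries.coeff m g = 0 := by
  have hζ : IsPrimitiveRoot (Complex.exp (2 * Real.pi * Complex.I / (7 : ℕ))) 7 :=
    Complex.isPrimitiveRoot_exp 7 (by norm_num)
  set ζ := Complex.exp (2 * Real.pi * Complex.I / (7 : ℕ))
  have hC : rescale ζ (PowerSeries.C α) = PowerSeries.C α := by
    ext n
    rw [coeff_rescale, PowerSeries.coeff_C]
    split_ifs with h <;> simp [h]
  have h1 : autonomousPart (rescale ζ g) - PowerSeries.C α = rescale ζ g := by
    rw [autonomousPart_rescale hζ.pow_eq_one]
    conv_rhs => rw [← hg]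
    rw [map_sub, hC]
  have h2 := congrArg (PowerSeries.coeff m) ((existsUnique_autonomousPart_sub α).unique h1 hg)
  rw [coeff_rescale] at h2
  by_contra h3
  exact hm ((hζ.pow_eq_one_iff_dvd m).1 (mul_right_cancel₀ h3 (by rw [h2, one_mul])))

end PowerSeriesSolutions

/-! ### From power series to Laurent series in `1/z`. -/

section ExpansionsAtInfinity

local notation "κ" => HahnSeries.ofPowerSeries ℤ ℂ

theorem laurent_derivative_coe (f : PowerSeries ℂ) :
    LaurentSeries.derivative ℂ (κ f) = κ (PowerSeries.derivative ℂ f) := by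
  ext n
  rw [LaurentSeries.derivative_apply, LaurentSeries.hasseDeriv_coeff, Nat.cast_one,
    Ring.choose_one_right, PowerSeries.coeff_coe, PowerSeries.coeff_coe]
  rcases lt_trichotomy n (-1) with h | rfl | h
  · simp [show n + 1 < 0 by omega, show n < 0 by omega]
  · simp
  · lift n to ℕ using (by omega)
    rw [if_neg (by omega), if_neg (by omega), show ((n : ℤ) + 1).natAbs = n + 1 by omega,
      Int.natAbs_natCast, PowerSeries.coeff_derivative, zsmul_eq_mul]
    push_cast
    ring

theorem laurent_derivative_single_mul (n : ℤ) (x : LaurentSeries ℂ) :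
    LaurentSeries.derivative ℂ (HahnSeries.single n 1 * x) =
      HahnSeries.single (n - 1) (n : ℂ) * x +
        HahnSeries.single n 1 * LaurentSeries.derivative ℂ x := by
  ext k
  simp only [LaurentSeries.derivative_apply, LaurentSeries.hasseDeriv_coeff, Nat.cast_one,
    Ring.choose_one_right, HahnSeries.coeff_add, HahnSeries.coeff_single_mul, one_mul,
    zsmul_eq_mul]
  rw [show k - (n - 1) = k + 1 - n by ring, show k - n + 1 = k + 1 - n by ring]
  push_cast
  ring

/-- Writing each factor as a power of `t` times a power series reduces the Leibniz rule to that for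
power series. -/
theorem laurent_derivative_mul (x y : LaurentSeries ℂ) :
    LaurentSeries.derivative ℂ (x * y) =
      x * LaurentSeries.derivative ℂ y + y * LaurentSeries.derivative ℂ x := by
  rw [← x.single_order_mul_powerSeriesPart, ← y.single_order_mul_powerSeriesPart]
  generalize x.order = n
  generalize y.order = m
  generalize x.powerSeriesPart = f
  generalize y.powerSeriesPart = g
  have h1 : HahnSeries.single n 1 * κ f * (HahnSeries.single m 1 * κ g) =
      HahnSeries.single (n + m) 1 * κ (f * g) := by
    rw [map_mul, mul_mul_mul_comm, HahnSeries.single_mul_single, one_mul]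
  have h2 : (HahnSeries.single (n + m - 1) ((n + m : ℤ) : ℂ) : LaurentSeries ℂ) =
      HahnSeries.single n 1 * HahnSeries.single (m - 1) (m : ℂ) +
      HahnSeries.single m 1 * HahnSeries.single (n - 1) (n : ℂ) := by
    rw [HahnSeries.single_mul_single, HahnSeries.single_mul_single,
      show n + (m - 1) = n + m - 1 by ring, show m + (n - 1) = n + m - 1 by ring, ← HahnSeries.single_add]
    push_cast
    ring_nf
  have h3 : (HahnSeries.single (n + m) (1 : ℂ) : LaurentSeries ℂ) =
      HahnSeries.single n 1 * HahnSeries.single m 1 := by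
    rw [HahnSeries.single_mul_single, one_mul]
  rw [h1, laurent_derivative_single_mul, laurent_derivative_single_mul,
    laurent_derivative_single_mul, laurent_derivative_coe, laurent_derivative_coe,
    laurent_derivative_coe, Derivation.leibniz, h2, h3]
  simp only [map_add, smul_eq_mul, map_mul]
  ring

theorem derivAtInfinity_add (x y : LaurentSeries ℂ) :
    derivAtInfinity (x + y) = derivAtInfinity x + derivAtInfinity y := by
  rw [derivAtInfinity, derivAtInfinity, derivAtInfinity, map_add]
  ring

theorem derivAtInfinity_mul (x y : LaurentSeries ℂ) :
    derivAtInfinity (x * y) = x * derivAtInfinity y + y * derivAtInfinity x := by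
  rw [derivAtInfinity, derivAtInfinity, derivAtInfinity, laurent_derivative_mul]
  ring

theorem derivAtInfinity_coe (f : PowerSeries ℂ) : derivAtInfinity (κ f) = κ (tDeriv f) := by
  rw [derivAtInfinity, laurent_derivative_coe, tDeriv, map_neg, map_mul,
    HahnSeries.ofPowerSeries_X_pow]
  rfl

theorem sixthOrder_coe_X_mul (α : ℂ) (g : PowerSeries ℂ) :
    sixthOrder derivAtInfinity (HahnSeries.single (-1) 1) (HahnSeries.C α)
      (κ (PowerSeries.X * g)) = κ (autonomousPart g - PowerSeries.C α - g) := by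
  have h := sixthOrder_map κ tDeriv derivAtInfinity derivAtInfinity_coe 0 0 (PowerSeries.X * g)
  have hz : (HahnSeries.single (-1) (1 : ℂ) : LaurentSeries ℂ) * κ (PowerSeries.X * g) = κ g := by
    rw [map_mul, HahnSeries.ofPowerSeries_X, ← mul_assoc, HahnSeries.single_mul_single]
    simp
  rw [map_sub, map_sub, autonomousPart, ← h, map_zero, HahnSeries.ofPowerSeries_C, sixthOrder,
    sixthOrder, hz]
  ring

theorem isExpansionAtInfinity_coe_iff {α : ℂ} {g : PowerSeries ℂ} :
    IsExpansionAtInfinity α (κ (PowerSeries.X * g)) ↔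
      autonomousPart g - PowerSeries.C α = g := by
  rw [IsExpansionAtInfinity, sixthOrder_coe_X_mul, map_eq_zero_iff _
    HahnSeries.ofPowerSeries_injective, sub_eq_zero]
  refine ⟨fun h => h.2, fun h => ⟨fun k hk => ?_, h⟩⟩
  rw [coeffAtInfinity, PowerSeries.coeff_coe]
  rcases hk.eq_or_lt with rfl | hk
  · simp
  · rw [if_pos (by omega)]

theorem exists_eq_coe_X_mul {W : LaurentSeries ℂ}
    (h : ∀ k : ℤ, 0 ≤ k → coeffAtInfinity W k = 0) :
    ∃ g : PowerSeries ℂ, W = κ (PowerSeries.X * g) := by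
  refine ⟨PowerSeries.mk fun m => W.coeff (m + 1), ?_⟩
  ext n
  rw [PowerSeries.coeff_coe]
  split_ifs with hn
  · simpa [coeffAtInfinity] using h (-n) (by omega)
  · lift n to ℕ using (by omega)
    rcases n with _ | n
    · simpa [coeffAtInfinity] using h 0 le_rfl
    · rw [Int.natAbs_natCast, PowerSeries.coeff_succ_X_mul, PowerSeries.coeff_mk]
      simp

theorem coeffAtInfinity_coe_X_mul (g : PowerSeries ℂ) (m : ℕ) :
    coeffAtInfinity (κ (PowerSeries.X * g)) (-((m : ℤ) + 1)) = PowerSeries.coeff m g := by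
  rw [coeffAtInfinity, PowerSeries.coeff_coe, neg_neg, if_neg (by omega),
    show ((m : ℤ) + 1).natAbs = m + 1 by omega, PowerSeries.coeff_succ_X_mul]

theorem existsUnique_isExpansionAtInfinity (α : ℂ) :
    ∃! W : LaurentSeries ℂ, IsExpansionAtInfinity α W := by
  obtain ⟨g, hg, huniq⟩ := existsUnique_autonomousPart_sub α
  refine ⟨κ (PowerSeries.X * g), isExpansionAtInfinity_coe_iff.2 hg, fun W hW => ?_⟩
  obtain ⟨f, rfl⟩ := exists_eq_coe_X_mul hW.1
  rw [huniq f (isExpansionAtInfinity_coe_iff.1 hW)]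

theorem coeffAtInfinity_eq_zero {α : ℂ} {W : LaurentSeries ℂ} (hW : IsExpansionAtInfinity α W)
    {m : ℕ} (hm : ¬ 7 ∣ m) : coeffAtInfinity W (-((m : ℤ) + 1)) = 0 := by
  obtain ⟨g, rfl⟩ := exists_eq_coe_X_mul hW.1
  rw [coeffAtInfinity_coe_X_mul]
  exact coeff_eq_zero_of_autonomousPart_sub (isExpansionAtInfinity_coe_iff.1 hW) hm

end ExpansionsAtInfinity

/-! ### Expansion of rational solutions and power sums of roots. -/

section RationalSolutionsAtInfinity

local notation "ι" => algebraMap ℂ[X] (RatFunc ℂ)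

local notation "κ" => HahnSeries.ofPowerSeries ℤ ℂ

/-- The expansion of a polynomial in `z` as a Laurent series in `t = 1 / z`. -/
noncomputable def polyAtInfinity : ℂ[X] →+* LaurentSeries ℂ :=
  eval₂RingHom HahnSeries.C (HahnSeries.single (-1) 1)

theorem polyAtInfinity_C (a : ℂ) : polyAtInfinity (C a) = HahnSeries.C a := by
  simp [polyAtInfinity]

theorem polyAtInfinity_X : polyAtInfinity X = HahnSeries.single (-1) 1 := by
  simp [polyAtInfinity]

theorem coeff_polyAtInfinity (p : ℂ[X]) (k : ℕ) :
    (polyAtInfinity p).coeff (-(k : ℤ)) = p.coeff k := by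
  induction p using Polynomial.induction_on' with
  | add p q hp hq => rw [map_add, HahnSeries.coeff_add, hp, hq, Polynomial.coeff_add]
  | monomial n a =>
    rw [← C_mul_X_pow_eq_monomial, map_mul, map_pow, polyAtInfinity_C, polyAtInfinity_X,
      HahnSeries.single_pow, HahnSeries.C_apply, HahnSeries.single_mul_single, coeff_C_mul_X_pow,
      HahnSeries.coeff_single]
    simp

theorem polyAtInfinity_injective : Function.Injective polyAtInfinity := by
  rw [injective_iff_map_eq_zero]
  intro p hp
  ext k
  rw [← coeff_polyAtInfinity, hp, HahnSeries.coeff_zero, Polynomial.coeff_zero]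

theorem derivAtInfinity_C (a : ℂ) : derivAtInfinity (HahnSeries.C a) = 0 := by
  rw [← HahnSeries.ofPowerSeries_C, derivAtInfinity_coe, tDeriv, PowerSeries.derivative_C, mul_zero,
    neg_zero, map_zero]

theorem derivAtInfinity_single_neg_one : derivAtInfinity (HahnSeries.single (-1) 1) = 1 := by
  have h := laurent_derivative_single_mul (-1) (κ 1)
  rw [laurent_derivative_coe, PowerSeries.derivative_one, map_zero, mul_zero, add_zero, map_one κ,
    mul_one, mul_one] at h
  rw [derivAtInfinity, h, HahnSeries.single_mul_single]
  simp [← HahnSeries.single_neg]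

theorem derivAtInfinity_polyAtInfinity (p : ℂ[X]) :
    derivAtInfinity (polyAtInfinity p) = polyAtInfinity (derivative p) := by
  induction p using Polynomial.induction_on with
  | C a => rw [polyAtInfinity_C, derivAtInfinity_C, derivative_C, map_zero]
  | add p q hp hq => rw [map_add, derivAtInfinity_add, hp, hq, derivative_add, map_add]
  | monomial n a ih =>
    rw [pow_succ, ← mul_assoc, map_mul, derivAtInfinity_mul, ih, derivative_mul (f := C a * X ^ n),
      polyAtInfinity_X, derivAtInfinity_single_neg_one, derivative_X, mul_one, mul_one, map_add,
      map_mul polyAtInfinity _ X, polyAtInfinity_X]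
    ring

/-- The Laurent expansion of a rational function at infinity. -/
noncomputable def ratAtInfinity : RatFunc ℂ →+* LaurentSeries ℂ :=
  RatFunc.liftRingHom polyAtInfinity
    (nonZeroDivisors_le_comap_nonZeroDivisors_of_injective _ polyAtInfinity_injective)

theorem ratAtInfinity_algebraMap (p : ℂ[X]) : ratAtInfinity (ι p) = polyAtInfinity p :=
  RatFunc.liftRingHom_algebraMap _ _ _

theorem polyAtInfinity_ne_zero {p : ℂ[X]} (hp : p ≠ 0) : polyAtInfinity p ≠ 0 :=
  (map_ne_zero_iff _ polyAtInfinity_injective).2 hp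

theorem derivAtInfinity_ratAtInfinity (f : RatFunc ℂ) :
    derivAtInfinity (ratAtInfinity f) = ratAtInfinity (ratDeriv f) := by
  obtain ⟨p, q, hq, rfl⟩ := exists_eq_algebraMap_div f
  have hq' := polyAtInfinity_ne_zero hq
  rw [ratDeriv_div _ _ hq]
  simp only [map_div₀, map_sub, map_mul, map_pow, ratAtInfinity_algebraMap]
  have h : derivAtInfinity (polyAtInfinity p / polyAtInfinity q * polyAtInfinity q) =
      polyAtInfinity (derivative p) := by
    rw [div_mul_cancel₀ _ hq', derivAtInfinity_polyAtInfinity]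
  rw [derivAtInfinity_mul, derivAtInfinity_polyAtInfinity] at h
  rw [← h]
  field_simp
  ring

/-- The geometric series `1/(z - a) = ∑ a^m t^(m+1)`. -/
theorem polyAtInfinity_X_sub_C_mul (a : ℂ) :
    polyAtInfinity (X - C a) * κ (PowerSeries.X * PowerSeries.mk fun m => a ^ m) = 1 := by
  have h : (1 - PowerSeries.C a * PowerSeries.X) * PowerSeries.mk (fun m => a ^ m) = 1 := by
    ext n
    rw [sub_mul, one_mul, mul_assoc, map_sub, PowerSeries.coeff_C_mul]
    rcases n with _ | n
    · simp
    · rw [PowerSeries.coeff_succ_X_mul, PowerSeries.coeff_mk, PowerSeries.coeff_mk,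
        PowerSeries.coeff_one, if_neg n.succ_ne_zero]
      ring
  have hz : (HahnSeries.single (-1) (1 : ℂ) : LaurentSeries ℂ) * HahnSeries.single 1 1 = 1 := by
    rw [HahnSeries.single_mul_single]; simp
  have h' := congrArg κ h
  rw [map_mul, map_sub, map_mul, map_one, HahnSeries.ofPowerSeries_C,
    HahnSeries.ofPowerSeries_X] at h'
  rw [map_sub, polyAtInfinity_X, polyAtInfinity_C, map_mul, HahnSeries.ofPowerSeries_X]
  linear_combination h' + κ (PowerSeries.mk fun m => a ^ m) * hz

/-- The generating series of the power sums of the roots. -/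
noncomputable def powerSumSeries (P : ℂ[X]) : PowerSeries ℂ := PowerSeries.mk (rootPowerSum P)

theorem polyAtInfinity_derivative_multiset_prod (s : Multiset ℂ) :
    polyAtInfinity (derivative (s.map fun a => X - C a).prod) =
      polyAtInfinity (s.map fun a => X - C a).prod *
        κ (PowerSeries.X * PowerSeries.mk fun m => (s.map fun a => a ^ m).sum) := by
  induction s using Multiset.induction_on with
  | empty =>
    have : (PowerSeries.mk fun _ => 0 : PowerSeries ℂ) = 0 := by ext; simp
    simp [this]
  | cons a s ih =>
    have h := polyAtInfinity_X_sub_C_mul a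
    have hs : (PowerSeries.mk fun m => ((a ::ₘ s).map fun b => b ^ m).sum : PowerSeries ℂ) =
        (PowerSeries.mk fun m => a ^ m) + PowerSeries.mk fun m => (s.map fun b => b ^ m).sum := by
      ext m
      simp
    rw [hs, mul_add, map_add, Multiset.map_cons, Multiset.prod_cons, derivative_mul,
      derivative_X_sub_C, one_mul, map_add, map_mul, map_mul, ih]
    linear_combination (-polyAtInfinity (s.map fun a => X - C a).prod) * h

theorem polyAtInfinity_derivative {P : ℂ[X]} (hP : P.Monic) :
    polyAtInfinity (derivative P) =
      polyAtInfinity P * κ (PowerSeries.X * powerSumSeries P) := by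
  have h := polyAtInfinity_derivative_multiset_prod P.roots
  rwa [← (IsAlgClosed.splits P).eq_prod_roots_of_monic hP] at h

theorem ratAtInfinity_ratLogDeriv_div {P Q : ℂ[X]} (hP : P.Monic) (hQ : Q.Monic) :
    ratAtInfinity (ratLogDeriv (ι P / ι Q)) =
      κ (PowerSeries.X * (powerSumSeries P - powerSumSeries Q)) := by
  rw [ratLogDeriv_div hP.ne_zero hQ.ne_zero, map_sub, map_div₀, map_div₀,
    ratAtInfinity_algebraMap, ratAtInfinity_algebraMap, ratAtInfinity_algebraMap,
    ratAtInfinity_algebraMap, polyAtInfinity_derivative hP, polyAtInfinity_derivative hQ,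
    mul_div_cancel_left₀ _ (polyAtInfinity_ne_zero hP.ne_zero),
    mul_div_cancel_left₀ _ (polyAtInfinity_ne_zero hQ.ne_zero), mul_sub, map_sub]

theorem ratAtInfinity_X : ratAtInfinity RatFunc.X = HahnSeries.single (-1) 1 := by
  rw [← RatFunc.algebraMap_X, ratAtInfinity_algebraMap, polyAtInfinity_X]

theorem IsSpecialFamily.isExpansionAtInfinity {Q : ℕ → ℂ[X]} (h : IsSpecialFamily Q) {n : ℕ}
    (hn : 1 ≤ n) : IsExpansionAtInfinity n
      (κ (PowerSeries.X * (powerSumSeries (Q (n - 1)) - powerSumSeries (Q n)))) := by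
  obtain ⟨-, hm, hode⟩ := h
  have hα : ratAtInfinity (n : RatFunc ℂ) = HahnSeries.C (n : ℂ) := by
    rw [map_natCast, map_natCast]
  have hmap := sixthOrder_map ratAtInfinity ratDeriv derivAtInfinity derivAtInfinity_ratAtInfinity
    RatFunc.X (n : RatFunc ℂ) (ratLogDeriv (ι (Q (n - 1)) / ι (Q n)))
  rw [hode n hn, map_zero, ratAtInfinity_ratLogDeriv_div (hm _) (hm _), ratAtInfinity_X, hα,
    sixthOrder_coe_X_mul, map_eq_zero_iff _ HahnSeries.ofPowerSeries_injective, sub_eq_zero] at hmap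
  exact isExpansionAtInfinity_coe_iff.2 hmap

theorem IsSpecialFamily.coeffAtInfinity_eq {Q : ℕ → ℂ[X]} (h : IsSpecialFamily Q) {n : ℕ}
    (hn : 1 ≤ n) {W : LaurentSeries ℂ} (hW : IsExpansionAtInfinity n W) (m : ℕ) :
    coeffAtInfinity W (-((m : ℤ) + 1)) =
      rootPowerSum (Q (n - 1)) m - rootPowerSum (Q n) m := by
  rw [(existsUnique_isExpansionAtInfinity n).unique hW (h.isExpansionAtInfinity hn),
    coeffAtInfinity_coe_X_mul, map_sub, powerSumSeries, powerSumSeries, PowerSeries.coeff_mk,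
    PowerSeries.coeff_mk]

theorem rootPowerSum_zero (P : ℂ[X]) : rootPowerSum P 0 = P.natDegree := by
  simp [rootPowerSum, (IsAlgClosed.splits P).natDegree_eq_card_roots]

theorem rootPowerSum_one (m : ℕ) : rootPowerSum 1 m = 0 := by
  simp [rootPowerSum]

/-- The power sum at `m = 0` gives the degree; all of them together give `P'/P = Q'/Q`. -/
theorem eq_of_rootPowerSum_eq {P Q : ℂ[X]} (hP : P.Monic) (hQ : Q.Monic)
    (h : ∀ m, rootPowerSum P m = rootPowerSum Q m) : P = Q := by
  refine eq_of_derivative_mul_eq hP hQ ?_ ?_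
  · exact_mod_cast (rootPowerSum_zero P).symm.trans ((h 0).trans (rootPowerSum_zero Q))
  · apply polyAtInfinity_injective
    have hs : powerSumSeries P = powerSumSeries Q := by
      ext m
      simpa [powerSumSeries] using h m
    rw [map_mul, map_mul, polyAtInfinity_derivative hP, polyAtInfinity_derivative hQ, hs]
    ring

theorem IsSpecialFamily.unique {P Q : ℕ → ℂ[X]} (hP : IsSpecialFamily P)
    (hQ : IsSpecialFamily Q) : P = Q := by
  funext n
  refine eq_of_rootPowerSum_eq (hP.2.1 n) (hQ.2.1 n) fun m => ?_
  induction n with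
  | zero => rw [hP.1, hQ.1]
  | succ n ih =>
    obtain ⟨W, hW, -⟩ := existsUnique_isExpansionAtInfinity ((n + 1 : ℕ) : ℂ)
    have h1 := hP.coeffAtInfinity_eq n.succ_pos hW m
    have h2 := hQ.coeffAtInfinity_eq n.succ_pos hW m
    rw [Nat.succ_sub_one] at h1 h2
    linear_combination ih + h1 - h2

theorem IsSpecialFamily.natDegree_eq {Q : ℕ → ℂ[X]} (hQ : IsSpecialFamily Q) (n : ℕ) :
    (Q n).natDegree = n * (n + 1) / 2 := by
  obtain ⟨P, hP, hd⟩ := exists_isSpecialFamily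
  have h := hd n
  rw [hP.unique hQ] at h
  rw [mul_add, mul_one]
  omega

/-- As 7 does not divide 1, the coefficient at `m = 1` vanishes, which puts the single root of `Q 1`
at `0`. This is why the final sum can start at `i = 2`. -/
theorem IsSpecialFamily.rootPowerSum_one_eq_zero {Q : ℕ → ℂ[X]} (hQ : IsSpecialFamily Q) {m : ℕ}
    (hm : 1 ≤ m) : rootPowerSum (Q 1) m = 0 := by
  obtain ⟨W, hW, -⟩ := existsUnique_isExpansionAtInfinity ((1 : ℕ) : ℂ)
  have h1 := hQ.coeffAtInfinity_eq le_rfl hW 1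
  rw [coeffAtInfinity_eq_zero hW (by norm_num), Nat.sub_self, hQ.1, rootPowerSum_one, zero_sub,
    eq_comm, neg_eq_zero] at h1
  have hc : Multiset.card (Q 1).roots = 1 := by
    rw [← (IsAlgClosed.splits (Q 1)).natDegree_eq_card_roots, hQ.natDegree_eq]
  obtain ⟨a, ha⟩ := Multiset.card_eq_one.1 hc
  rw [rootPowerSum, ha, Multiset.map_singleton, Multiset.sum_singleton] at h1 ⊢
  rw [pow_one] at h1
  rw [h1, zero_pow (by omega)]

theorem IsSpecialFamily.rootPowerSum_eq {Q : ℕ → ℂ[X]} (hQ : IsSpecialFamily Q)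
    {W : ℕ → LaurentSeries ℂ} (hW : ∀ i : ℕ, IsExpansionAtInfinity (i : ℂ) (W i)) {n m : ℕ}
    (hn : 1 ≤ n) (hm : 1 ≤ m) :
    rootPowerSum (Q n) m =
      -∑ i ∈ Finset.Icc 2 n, coeffAtInfinity (W i) (-((m : ℤ) + 1)) := by
  induction n, hn using Nat.le_induction with
  | base => simp [hQ.rootPowerSum_one_eq_zero hm]
  | succ n hn ih =>
    have h := hQ.coeffAtInfinity_eq n.succ_pos (hW (n + 1)) m
    rw [Nat.succ_sub_one] at h
    rw [Finset.sum_Icc_succ_top (by omega), h]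
    linear_combination ih

end RationalSolutionsAtInfinity

end PainleveTwo

theorem mainTheorem7 :
    (∃! Q : ℕ → Polynomial ℂ, PainleveTwo.IsSpecialFamily Q) ∧
    (∀ α : ℂ, ∃! W : LaurentSeries ℂ, PainleveTwo.IsExpansionAtInfinity α W) ∧
    (∀ (α : ℂ) (W : LaurentSeries ℂ), PainleveTwo.IsExpansionAtInfinity α W →
      ∀ m : ℕ, ¬ 7 ∣ m → PainleveTwo.coeffAtInfinity W (-((m : ℤ) + 1)) = 0) ∧
    ∀ Q : ℕ → Polynomial ℂ, PainleveTwo.IsSpecialFamily Q →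
      (∀ n : ℕ, (Q n).natDegree = n * (n + 1) / 2) ∧
      ∀ W : ℕ → LaurentSeries ℂ,
        (∀ i : ℕ, PainleveTwo.IsExpansionAtInfinity (i : ℂ) (W i)) →
        ∀ n m : ℕ, 2 ≤ n → 1 ≤ m →
          PainleveTwo.rootPowerSum (Q n) m =
            -∑ i ∈ Finset.Icc 2 n, PainleveTwo.coeffAtInfinity (W i) (-((m : ℤ) + 1)) := by
  refine ⟨?_, PainleveTwo.existsUnique_isExpansionAtInfinity,
    fun _ _ hW _ hm => PainleveTwo.coeffAtInfinity_eq_zero hW hm,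
    fun Q hQ => ⟨hQ.natDegree_eq, fun W hW n m hn hm => hQ.rootPowerSum_eq hW (by omega) hm⟩⟩
  obtain ⟨Q, hQ, -⟩ := PainleveTwo.exists_isSpecialFamily
  exact ⟨Q, hQ, fun P hP => hP.unique hQ⟩
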